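/- For $n\in\{1,2,3,\ldots\}\cup\{\infty\}$ let $\mathbb{F}_n$ be the free group of rank $n$ (countably infinite rank if $n=\infty$) with free generators $g^{(n)}_i$. Let $C^*(\mathbb{F}_n)$ be its full group C$^*$-algebra (the C$^*$-algebra generated by the image of $\mathbb{F}_n$ under its universal unitary representation) and $C^*_r(\mathbb{F}_n)$ its reduced group C$^*$-algebra (the C$^*$-algebra generated by the image of the left regular representation on $\ell^2(\mathbb{F}_n)$). We write $g^{(n)}_i$ also for the corresponding unitary in $C^*(\mathbb{F}_n)$ and in $C^*_r(\mathbb{F}_n)$, and $\otimes$ for the minimal C$^*$-tensor product. (i) For $1\le n,m<\infty$ there is a unique unital $*$-homomorphism $\varphi_{n,m}:C^*(\mathbb{F}_{nm})\to C^*(\mathbb{F}_n)\otimes C^*(\mathbb{F}_m)$ such that $$\varphi_{n,m}\bigl(g^{(nm)}_{m(i-1)+j}\bigr)=g^{(n)}_i\otimes g^{(m)}_j\qquad(i=1,\ldots,n,\ j=1,\ldots,m).$$ (ii) For $1\le n<\infty$ there is a unique unital $*$-homomorphism $\varphi_{\infty,n}:C^*(\mathbb{F}_\infty)\to C^*(\mathbb{F}_\infty)\otimes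 C^*(\mathbb{F}_n)$ such that $$\varphi_{\infty,n}\bigl(g^{(\infty)}_{n(i-1)+j}\bigr)=g^{(\infty)}_i\otimes g^{(n)}_j\qquad(i\ge 1,\ j=1,\ldots,n).$$ (iii) If $2\le n,m<\infty$, then $\varphi_{n,m}$ is not injective. (iv) If $2\le n,m<\infty$, then there is no $*$-homomorphism $\psi:C^*_r(\mathbb{F}_{nm})\to C^*_r(\mathbb{F}_n)\otimes C^*_r(\mathbb{F}_m)$, unital or not, such that $\psi\bigl(g^{(nm)}_{m(i-1)+j}\bigr)=g^{(n)}_i\otimes g^{(m)}_j$ for all $i=1,\ldots,n$ and $j=1,\ldots,m$. -/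

import Mathlib

open scoped TensorProduct ENNReal

universe u v

noncomputable section

/-! ## The C⋆-algebra generated by a unitary representation -/

section Generated

variable {G : Type u} [Group G] {H : Type v} [NormedAddCommGroup H] [InnerProductSpace ℂ H]
  [CompleteSpace H]

/-- The C⋆-algebra of operators on the Hilbert space `H` generated by the unitaries `ρ g`, `g ∈ G`:
the norm closure in `B(H)` of the `⋆`-algebra generated by these operators, equivalently, of the
image of the group algebra `ℂ[G]` (or of `ℓ¹(G)`) under `ρ`. -/
def generatedCStar (ρ : G →* (H ≃ₗᵢ[ℂ] H)) : StarSubalgebra ℂ (H →L[ℂ] H) :=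
  (StarAlgebra.adjoin ℂ
    (Set.range fun g : G => ((ρ g).toContinuousLinearEquiv : H →L[ℂ] H))).topologicalClosure

instance generatedCStar_isClosed (ρ : G →* (H ≃ₗᵢ[ℂ] H)) :
    IsClosed (generatedCStar ρ : Set (H →L[ℂ] H)) :=
  StarSubalgebra.isClosed_topologicalClosure _

/-- The unitary operator `ρ g`, as an element of the C⋆-algebra generated by `ρ`. -/
def generatedCStar.of (ρ : G →* (H ≃ₗᵢ[ℂ] H)) (g : G) : generatedCStar ρ :=
  ⟨((ρ g).toContinuousLinearEquiv : H →L[ℂ] H),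
    StarSubalgebra.le_topologicalClosure _ (StarAlgebra.subset_adjoin ℂ _ ⟨g, rfl⟩)⟩

end Generated

/-! ## The full group C⋆-algebra -/

/-- A unitary representation of the discrete group `G` on a complex Hilbert space. -/
structure UnitaryRep (G : Type u) [Group G] : Type (u + 1) where
  /-- The Hilbert space. -/
  space : Type u
  [normedAddCommGroup : NormedAddCommGroup space]
  [innerProductSpace : InnerProductSpace ℂ space]
  [completeSpace : CompleteSpace space]
  /-- The homomorphism to the unitary group. -/
  rep : G →* (space ≃ₗᵢ[ℂ] space)

attribute [instance] UnitaryRep.normedAddCommGroup UnitaryRep.innerProductSpace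
  UnitaryRep.completeSpace

section DirectSum

variable {ι : Type u} {E : ι → Type v} [∀ i, NormedAddCommGroup (E i)]
  [∀ i, InnerProductSpace ℂ (E i)]

theorem memℓp_two_unitary (U : ∀ i, E i ≃ₗᵢ[ℂ] E i) (x : lp E 2) :
    Memℓp (fun i => U i (x i)) 2 := by
  have h := (lp.memℓp x).summable (by norm_num)
  refine memℓp_gen ?_
  simpa using h

/-- The direct sum of unitary operators, on the Hilbert space direct sum: it acts by
`(⊕ U) x = (U i (x i))_i`. -/
def directSumUnitary (U : ∀ i, E i ≃ₗᵢ[ℂ] E i) : lp E 2 ≃ₗᵢ[ℂ] lp E 2 where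
  toFun x := ⟨fun i => U i (x i), memℓp_two_unitary U x⟩
  invFun x := ⟨fun i => (U i).symm (x i), memℓp_two_unitary (fun i => (U i).symm) x⟩
  map_add' x y := by
    ext i
    exact map_add (U i) (x i) (y i)
  map_smul' c x := by
    ext i
    simp
  left_inv x := by
    ext i
    simp
  right_inv x := by
    ext i
    simp
  norm_map' x := by
    rw [lp.norm_eq_tsum_rpow (by norm_num), lp.norm_eq_tsum_rpow (by norm_num)]
    simp

@[simp]
theorem directSumUnitary_apply (U : ∀ i, E i ≃ₗᵢ[ℂ] E i) (x : lp E 2) (i : ι) :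
    directSumUnitary U x i = U i (x i) := rfl

end DirectSum

/-- The Hilbert space of the universal representation of `G`: the Hilbert space direct sum of the
spaces of all unitary representations of `G`. -/
abbrev UniversalSpace (G : Type u) [Group G] : Type (u + 1) :=
  lp (fun π : UnitaryRep G => π.space) 2

/-- The universal representation of `G`: the direct sum of all unitary representations of `G`.
Every cyclic representation of `G`, in whatever universe, is unitarily equivalent to one of the
summands, so that the norm of an element of `ℂ[G]` in the universal representation is the supremum
of its norms in all unitary representations of `G`. -/
def universalRep (G : Type u) [Group G] : G →* (UniversalSpace G ≃ₗᵢ[ℂ] UniversalSpace G) where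
  toFun g := directSumUnitary fun π : UnitaryRep G => π.rep g
  map_one' := by
    ext x π
    simp
  map_mul' g h := by
    ext x π
    simp

/-- The full group C⋆-algebra `C⋆(G)` of the discrete group `G`. -/
abbrev FullGroupCStar (G : Type u) [Group G] :
    StarSubalgebra ℂ (UniversalSpace G →L[ℂ] UniversalSpace G) :=
  generatedCStar (universalRep G)

/-- The group element `g`, as a unitary in `C⋆(G)`. -/
abbrev FullGroupCStar.of {G : Type u} [Group G] (g : G) : FullGroupCStar G :=
  generatedCStar.of (universalRep G) g

/-! ## The reduced group C⋆-algebra -/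

section Regular

variable {G : Type u} [Group G]

theorem memℓp_two_translate (g : G) (x : lp (fun _ : G => ℂ) 2) :
    Memℓp (fun h => x (g⁻¹ * h)) 2 := by
  have h := (lp.memℓp x).summable (by norm_num)
  exact memℓp_gen (h.comp_injective (mul_right_injective g⁻¹))

/-- Left translation on `ℓ²(G)`: `(λ g x) h = x (g⁻¹ h)`. -/
def leftTranslation (g : G) : lp (fun _ : G => ℂ) 2 ≃ₗᵢ[ℂ] lp (fun _ : G => ℂ) 2 where
  toFun x := ⟨fun h => x (g⁻¹ * h), memℓp_two_translate g x⟩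
  invFun x := ⟨fun h => x (g * h), by
    have h := memℓp_two_translate g⁻¹ x
    rw [inv_inv] at h
    exact h⟩
  map_add' x y := by
    ext h
    rfl
  map_smul' c x := by
    ext h
    simp
  left_inv x := by
    ext h
    simp
  right_inv x := by
    ext h
    simp
  norm_map' x := by
    rw [lp.norm_eq_tsum_rpow (by norm_num), lp.norm_eq_tsum_rpow (by norm_num)]
    congr 1
    exact (Equiv.mulLeft g⁻¹).tsum_eq fun h => ‖x h‖ ^ (2 : ℝ≥0∞).toReal

@[simp]
theorem leftTranslation_apply (g : G) (x : lp (fun _ : G => ℂ) 2) (h : G) :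
    leftTranslation g x h = x (g⁻¹ * h) := rfl

end Regular

/-- The left regular representation of `G` on `ℓ²(G)`. -/
def regularRep (G : Type u) [Group G] :
    G →* (lp (fun _ : G => ℂ) 2 ≃ₗᵢ[ℂ] lp (fun _ : G => ℂ) 2) where
  toFun := leftTranslation
  map_one' := by
    ext x h
    simp
  map_mul' g k := by
    ext x h
    simp [mul_assoc]

/-- The reduced group C⋆-algebra `C⋆ᵣ(G)` of the discrete group `G`: the C⋆-algebra generated by
the left regular representation. -/
abbrev ReducedGroupCStar (G : Type u) [Group G] :
    StarSubalgebra ℂ (lp (fun _ : G => ℂ) 2 →L[ℂ] lp (fun _ : G => ℂ) 2) :=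
  generatedCStar (regularRep G)

/-- The group element `g`, as a unitary in `C⋆ᵣ(G)`. -/
abbrev ReducedGroupCStar.of {G : Type u} [Group G] (g : G) : ReducedGroupCStar G :=
  generatedCStar.of (regularRep G) g

/-! ## The minimal tensor product -/

section MinTensor

variable {H : Type u} [NormedAddCommGroup H] [InnerProductSpace ℂ H]
  {K : Type v} [NormedAddCommGroup K] [InnerProductSpace ℂ K]

/-- The Hilbert space tensor product: the completion of the algebraic tensor product, with
`⟪x ⊗ y, x' ⊗ y'⟫ = ⟪x, x'⟫ * ⟪y, y'⟫`. -/
def HilbertTensor (H : Type u) [NormedAddCommGroup H] [InnerProductSpace ℂ H]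
    (K : Type v) [NormedAddCommGroup K] [InnerProductSpace ℂ K] : Type (max u v) :=
  UniformSpace.Completion (H ⊗[ℂ] K)

instance : NormedAddCommGroup (HilbertTensor H K) :=
  inferInstanceAs (NormedAddCommGroup (UniformSpace.Completion (H ⊗[ℂ] K)))

instance : InnerProductSpace ℂ (HilbertTensor H K) :=
  inferInstanceAs (InnerProductSpace ℂ (UniformSpace.Completion (H ⊗[ℂ] K)))

instance : CompleteSpace (HilbertTensor H K) :=
  inferInstanceAs (CompleteSpace (UniformSpace.Completion (H ⊗[ℂ] K)))

/-- The inclusion of the algebraic tensor product in the Hilbert space tensor product. -/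
def HilbertTensor.incl : H ⊗[ℂ] K →ₗᵢ[ℂ] HilbertTensor H K :=
  (UniformSpace.Completion.toComplₗᵢ : H ⊗[ℂ] K →ₗᵢ[ℂ] UniformSpace.Completion (H ⊗[ℂ] K))

theorem HilbertTensor.denseRange_incl :
    DenseRange (HilbertTensor.incl : H ⊗[ℂ] K →ₗᵢ[ℂ] HilbertTensor H K) :=
  UniformSpace.Completion.denseRange_coe

variable [CompleteSpace H] [CompleteSpace K]

/-- The algebraic tensor product of bounded operators is bounded: bounded operators are
combinations of unitaries, and tensor products of unitaries are isometric. -/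
theorem continuous_tensorMap (S : H →L[ℂ] H) (T : K →L[ℂ] K) :
    Continuous (TensorProduct.map (S : H →ₗ[ℂ] H) (T : K →ₗ[ℂ] K)) := by
  have hS : S ∈ Submodule.span ℂ (unitary (H →L[ℂ] H) : Set (H →L[ℂ] H)) := by
    rw [CStarAlgebra.span_unitary]; trivial
  have hT : T ∈ Submodule.span ℂ (unitary (K →L[ℂ] K) : Set (K →L[ℂ] K)) := by
    rw [CStarAlgebra.span_unitary]; trivial
  induction hS using Submodule.span_induction with
  | mem S hS =>
    induction hT using Submodule.span_induction with
    | mem T hT =>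
      exact (TensorProduct.congrIsometry (Unitary.linearIsometryEquiv ⟨S, hS⟩)
        (Unitary.linearIsometryEquiv ⟨T, hT⟩)).continuous
    | zero =>
      rw [ContinuousLinearMap.toLinearMap_zero, TensorProduct.map_zero_right]
      exact continuous_const
    | add T T' _ _ h h' =>
      rw [ContinuousLinearMap.toLinearMap_add, TensorProduct.map_add_right]
      exact h.add h'
    | smul c T _ h =>
      rw [ContinuousLinearMap.toLinearMap_smul, TensorProduct.map_smul_right]
      exact h.const_smul c
  | zero =>
    rw [ContinuousLinearMap.toLinearMap_zero, TensorProduct.map_zero_left]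
    exact continuous_const
  | add S S' _ _ h h' =>
    rw [ContinuousLinearMap.toLinearMap_add, TensorProduct.map_add_left]
    exact h.add h'
  | smul c S _ h =>
    rw [ContinuousLinearMap.toLinearMap_smul, TensorProduct.map_smul_left]
    exact h.const_smul c

/-- The tensor product `S ⊗ T` of bounded operators, acting on the Hilbert space tensor product by
`(S ⊗ T) (x ⊗ y) = S x ⊗ T y`. -/
def opTensor (S : H →L[ℂ] H) (T : K →L[ℂ] K) : HilbertTensor H K →L[ℂ] HilbertTensor H K :=
  (ContinuousLinearMap.completion
    (⟨TensorProduct.map (S : H →ₗ[ℂ] H) (T : K →ₗ[ℂ] K), continuous_tensorMap S T⟩ :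
      H ⊗[ℂ] K →L[ℂ] H ⊗[ℂ] K) :
    UniformSpace.Completion (H ⊗[ℂ] K) →L[ℂ] UniformSpace.Completion (H ⊗[ℂ] K))

theorem opTensor_incl_tmul (S : H →L[ℂ] H) (T : K →L[ℂ] K) (x : H) (y : K) :
    opTensor S T (HilbertTensor.incl (x ⊗ₜ[ℂ] y)) = HilbertTensor.incl (S x ⊗ₜ[ℂ] T y) :=
  ContinuousLinearMap.completion_apply_coe
    (⟨TensorProduct.map (S : H →ₗ[ℂ] H) (T : K →ₗ[ℂ] K), continuous_tensorMap S T⟩ :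
      H ⊗[ℂ] K →L[ℂ] H ⊗[ℂ] K) (x ⊗ₜ[ℂ] y)

/-- The minimal (spatial) tensor product of C⋆-algebras of operators `A ⊆ B(H)` and `B ⊆ B(K)`:
the C⋆-algebra on the Hilbert space tensor product of `H` and `K` generated by the operators
`a ⊗ b` with `a ∈ A` and `b ∈ B`. -/
def minTensor (A : StarSubalgebra ℂ (H →L[ℂ] H)) (B : StarSubalgebra ℂ (K →L[ℂ] K)) :
    StarSubalgebra ℂ (HilbertTensor H K →L[ℂ] HilbertTensor H K) :=
  (StarAlgebra.adjoin ℂ {X | ∃ a ∈ A, ∃ b ∈ B, X = opTensor a b}).topologicalClosure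

instance minTensor_isClosed (A : StarSubalgebra ℂ (H →L[ℂ] H))
    (B : StarSubalgebra ℂ (K →L[ℂ] K)) :
    IsClosed (minTensor A B : Set (HilbertTensor H K →L[ℂ] HilbertTensor H K)) :=
  StarSubalgebra.isClosed_topologicalClosure _

/-- The elementary tensor `a ⊗ b` in the minimal tensor product. -/
def minTensor.tmul {A : StarSubalgebra ℂ (H →L[ℂ] H)} {B : StarSubalgebra ℂ (K →L[ℂ] K)}
    (a : A) (b : B) : minTensor A B :=
  ⟨opTensor (a : H →L[ℂ] H) (b : K →L[ℂ] K),
    StarSubalgebra.le_topologicalClosure _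
      (StarAlgebra.subset_adjoin ℂ _ ⟨a, a.2, b, b.2, rfl⟩)⟩

end MinTensor

/-! ## Generators of free groups -/

/-- The generators of the free group of rank `n * m`, indexed by pairs. With indices counted from
`1` as usual, the pair `(i, j)` gives the generator with number `m * (i - 1) + j`; with indices
counted from `0`, as in `Fin`, this is the number `m * i + j`. -/
def freeGen {n m : ℕ} (i : Fin n) (j : Fin m) : FreeGroup (Fin (n * m)) :=
  FreeGroup.of ⟨m * i + j, calc
    m * (i : ℕ) + j < m * i + m := Nat.add_lt_add_left j.2 _
    _ = m * (i + 1) := by ring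
    _ ≤ m * n := Nat.mul_le_mul_left m i.2
    _ = n * m := Nat.mul_comm m n⟩

/-- The generators of the free group of countably infinite rank, indexed by pairs. With indices
counted from `1`, the pair `(i, j)` gives the generator with number `n * (i - 1) + j`. -/
def freeGenInf {n : ℕ} (i : ℕ) (j : Fin n) : FreeGroup ℕ :=
  FreeGroup.of (n * i + j)

end

/-! Existence: `g ↦ p(g) ⊗ q(g)`, with `p` and `q` the maps to the two coordinates of a generator,
is a unitary representation of the free group with values in the minimal tensor product, and
`FullGroupCStar.exists_starAlgHom` extends it to `C⋆`. Uniqueness: generators determine all group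
elements, and these generate a dense `⋆`-algebra. The universal representation of `G` sums over
Hilbert spaces in the universe of `G` only. Its universal property therefore rests on cyclic
subspaces: each is the closed span of one orbit, hence has a copy in that universe.

Failure of injectivity: for the corners `a = (i₀, j₀)`, `b = (i₁, j₀)`, `c = (i₀, j₁)`, `d = (i₁,
j₁)` of a rectangle, the word `w = a b⁻¹ d c⁻¹` is reduced, but both coordinate maps send it to `1`.
So `w` and `1` have the same image, while they differ in `C⋆`.

Reduced algebras: all conjugates of `w` would be sent to `1`, so a sum of `k` of them would have
image of norm `k`. Powers' estimate `norm_sum_le_of_mapsTo_orthogonal`, applied to the conjugates by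
powers of `b`, bounds the norm of the sum by `2√k`. As `⋆`-homomorphisms are contractive, `k ≤ 2√k`,
which is false for `k = 5`. -/

noncomputable section

/-! ## Universal property of the full group C⋆-algebra -/

/-! ### Smallness of spans and closures. -/

section Small

theorem small_span {R : Type u} {M : Type v} [Semiring R] [AddCommMonoid M] [Module R M]
    (s : Set M) [Small.{u} s] : Small.{u} (Submodule.span R s) := by
  have h : Submodule.span R s = LinearMap.range (Finsupp.linearCombination R
      (fun i : Shrink.{u} s => (((equivShrink s).symm i : s) : M))) := by
    rw [Finsupp.range_linearCombination]
    congr 1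
    ext x
    constructor
    · intro hx
      exact ⟨equivShrink s ⟨x, hx⟩, by simp⟩
    · rintro ⟨i, rfl⟩
      exact Subtype.coe_prop _
  rw [h]
  exact small_range (Finsupp.linearCombination R
      (fun i : Shrink.{u} s => (((equivShrink s).symm i : s) : M)))

/-- Each point of the closure is the unique limit of a sequence in `s`, and there is only a small
set of such sequences. -/
theorem small_closure {X : Type v} [TopologicalSpace X] [T2Space X] [FirstCountableTopology X]
    (s : Set X) [Small.{u} s] : Small.{u} (closure s) := by
  -- The value at a divergent sequence is arbitrary; only the limits matter.
  let f : (ℕ → Shrink.{u} s) → X := fun a =>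
    open Classical in
    if h : ∃ x, Filter.Tendsto (fun k => (((equivShrink s).symm (a k) : s) : X)) Filter.atTop
      (nhds x) then h.choose else (((equivShrink s).symm (a 0) : s) : X)
  refine small_subset (s := Set.range f) fun x hx => ?_
  obtain ⟨a, ha, hx⟩ := mem_closure_iff_seq_limit.1 hx
  refine ⟨fun k => equivShrink s ⟨a k, ha k⟩, ?_⟩
  have h : ∃ x, Filter.Tendsto (fun k => (((equivShrink s).symm
      ((fun k => equivShrink s ⟨a k, ha k⟩) k) : s) : X)) Filter.atTop (nhds x) :=
    ⟨x, by simpa using hx⟩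
  have h' := h.choose_spec
  simp only [f]
  rw [dif_pos h]
  exact tendsto_nhds_unique h' (by simpa using hx)

instance Shrink.innerProductSpace {E : Type v} [Small.{u} E] [NormedAddCommGroup E]
    [InnerProductSpace ℂ E] : InnerProductSpace ℂ (Shrink.{u} E) where
  inner x y := inner ℂ ((equivShrink E).symm x) ((equivShrink E).symm y)
  norm_sq_eq_re_inner x := norm_sq_eq_re_inner (𝕜 := ℂ) ((equivShrink E).symm x)
  conj_inner_symm x y := inner_conj_symm _ _
  add_left x y z := by
    rw [equivShrink_symm_add, inner_add_left]
  smul_left x y c := by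
    rw [equivShrink_symm_smul, inner_smul_left]

/-- The identification of a small Hilbert space with its model in a lower universe. -/
def shrinkIsometry (E : Type v) [Small.{u} E] [NormedAddCommGroup E]
    [InnerProductSpace ℂ E] : Shrink.{u} E ≃ₗᵢ[ℂ] E where
  toLinearEquiv := Shrink.linearEquiv ℂ E
  norm_map' _ := rfl

end Small

/-! ### Cyclic subrepresentations. -/

section Cyclic

variable {G : Type u} [Group G] {K : Type v} [NormedAddCommGroup K] [InnerProductSpace ℂ K]

/-- The closed subspace spanned by the orbit of the vector `ξ`. -/
def cyclicSubspace (σ : G →* (K ≃ₗᵢ[ℂ] K)) (ξ : K) : Submodule ℂ K :=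
  (Submodule.span ℂ (Set.range fun g => σ g ξ)).topologicalClosure

theorem mem_cyclicSubspace (σ : G →* (K ≃ₗᵢ[ℂ] K)) (ξ : K) : ξ ∈ cyclicSubspace σ ξ :=
  Submodule.le_topologicalClosure _ (Submodule.subset_span ⟨1, by simp⟩)

theorem apply_mem_cyclicSubspace (σ : G →* (K ≃ₗᵢ[ℂ] K)) (ξ : K) (g : G) {x : K}
    (hx : x ∈ cyclicSubspace σ ξ) : σ g x ∈ cyclicSubspace σ ξ := by
  refine map_mem_closure (σ g).continuous hx fun y hy => ?_
  have : Submodule.span ℂ (Set.range fun g => σ g ξ) ≤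
      (Submodule.span ℂ (Set.range fun g => σ g ξ)).comap
        ((σ g).toLinearEquiv : K →ₗ[ℂ] K) := by
    rw [Submodule.span_le]
    rintro _ ⟨h, rfl⟩
    exact Submodule.subset_span ⟨g * h, by simp⟩
  exact this hy

theorem small_cyclicSubspace (σ : G →* (K ≃ₗᵢ[ℂ] K)) (ξ : K) :
    Small.{u} (cyclicSubspace σ ξ) := by
  -- `small_span` needs scalars in the universe of `G`, hence the lift of `ℂ`, which does not change
  -- the span.
  have h₁ : Small.{u} (Submodule.span (ULift.{u} ℂ) (Set.range fun g => σ g ξ)) := small_span _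
  have h₂ : (Submodule.span (ULift.{u} ℂ) (Set.range fun g => σ g ξ) : Set K) =
      Submodule.span ℂ (Set.range fun g => σ g ξ) := by
    refine Set.Subset.antisymm (fun x hx => ?_) fun x hx => ?_
    · induction hx using Submodule.span_induction with
      | mem x hx => exact Submodule.subset_span hx
      | zero => exact zero_mem _
      | add x y _ _ hx hy => exact add_mem hx hy
      | smul c x _ hx => exact Submodule.smul_mem _ c.down hx
    · induction hx using Submodule.span_induction with
      | mem x hx => exact Submodule.subset_span hx
      | zero => exact zero_mem _
      | add x y _ _ hx hy => exact add_mem hx hy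
      | smul c x _ hx => exact Submodule.smul_mem _ (ULift.up c) hx
  have h₃ : Small.{u} (Submodule.span ℂ (Set.range fun g => σ g ξ) : Set K) := h₂ ▸ h₁
  exact small_closure _

/-- The restriction of a unitary representation to a cyclic subspace. -/
def cyclicRep (σ : G →* (K ≃ₗᵢ[ℂ] K)) (ξ : K) :
    G →* (cyclicSubspace σ ξ ≃ₗᵢ[ℂ] cyclicSubspace σ ξ) where
  toFun g :=
    { toFun := fun x => ⟨σ g x, apply_mem_cyclicSubspace σ ξ g x.2⟩
      invFun := fun x => ⟨σ g⁻¹ x, apply_mem_cyclicSubspace σ ξ g⁻¹ x.2⟩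
      map_add' := fun x y => by ext; simp
      map_smul' := fun c x => by ext; simp
      left_inv := fun x => by ext; simp
      right_inv := fun x => by ext; simp
      norm_map' := fun x => by simp }
  map_one' := by ext; simp
  map_mul' g h := by ext; simp

/-- The cyclic representation generated by a vector, as a summand of the universal
representation. -/
def cyclicUnitaryRep [CompleteSpace K] (σ : G →* (K ≃ₗᵢ[ℂ] K)) (ξ : K) : UnitaryRep G :=
  haveI := small_cyclicSubspace σ ξ
  haveI : CompleteSpace (cyclicSubspace σ ξ) :=
    (Submodule.isClosed_topologicalClosure _).completeSpace_coe
  haveI : CompleteSpace (Shrink.{u} (cyclicSubspace σ ξ)) :=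
    (completeSpace_congr (e := (shrinkIsometry (cyclicSubspace σ ξ)).toLinearEquiv.toEquiv)
      (shrinkIsometry (cyclicSubspace σ ξ)).isometry.isUniformEmbedding).2 inferInstance
  { space := Shrink.{u} (cyclicSubspace σ ξ)
    rep :=
      { toFun := fun g => ((shrinkIsometry (cyclicSubspace σ ξ)).trans (cyclicRep σ ξ g)).trans
          (shrinkIsometry (cyclicSubspace σ ξ)).symm
        map_one' := by ext; simp
        map_mul' := fun g h => by ext; simp } }

/-- The cyclic representation of `ξ` is a summand of the universal one up to unitary equivalence;
`R` projects to this summand and embeds it isometrically in `K`. -/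
theorem exists_intertwiner [CompleteSpace K] (σ : G →* (K ≃ₗᵢ[ℂ] K)) (ξ : K) :
    ∃ R : UniversalSpace G →L[ℂ] K, (∀ x, ‖R x‖ ≤ ‖x‖) ∧
      (∀ g x, R (universalRep G g x) = σ g (R x)) ∧ ∃ η, R η = ξ ∧ ‖η‖ = ‖ξ‖ := by
  classical
  have := small_cyclicSubspace σ ξ
  let π := cyclicUnitaryRep σ ξ
  let V : π.space →ₗᵢ[ℂ] K := (cyclicSubspace σ ξ).subtypeₗᵢ.comp
    (shrinkIsometry (cyclicSubspace σ ξ)).toLinearIsometry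
  let e : π.space := (shrinkIsometry (cyclicSubspace σ ξ)).symm ⟨ξ, mem_cyclicSubspace σ ξ⟩
  have he : V e = ξ := by
    change (((shrinkIsometry (cyclicSubspace σ ξ)) ((shrinkIsometry (cyclicSubspace σ ξ)).symm
      ⟨ξ, mem_cyclicSubspace σ ξ⟩) : cyclicSubspace σ ξ) : K) = ξ
    simp
  have hV : ∀ g y, V (π.rep g y) = σ g (V y) := by
    intro g y
    change (((shrinkIsometry (cyclicSubspace σ ξ)) ((shrinkIsometry (cyclicSubspace σ ξ)).symm
      (cyclicRep σ ξ g (shrinkIsometry (cyclicSubspace σ ξ) y))) : cyclicSubspace σ ξ) : K) = _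
    simp only [LinearIsometryEquiv.apply_symm_apply]
    rfl
  refine ⟨V.toContinuousLinearMap ∘L lp.evalCLM ℂ (fun π : UnitaryRep G => π.space) 2 π,
    fun x => ?_, fun g x => hV g (x π), lp.single 2 π e, ?_, ?_⟩
  · change ‖V (x π)‖ ≤ ‖x‖
    rw [V.norm_map]
    exact lp.norm_apply_le_norm (by norm_num) x π
  · change V ((lp.single 2 π e : UniversalSpace G) π) = ξ
    rw [lp.single_apply_self, he]
  · rw [lp.norm_single (by norm_num), ← he, V.norm_map]

end Cyclic

section UniversalProperty

variable {G : Type u} [Group G] {K : Type v} [NormedAddCommGroup K] [InnerProductSpace ℂ K]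
  [CompleteSpace K]

theorem star_unitaryRep {H : Type*} [NormedAddCommGroup H] [InnerProductSpace ℂ H]
    [CompleteSpace H] (ρ : G →* (H ≃ₗᵢ[ℂ] H)) (g : G) :
    star ((ρ g).toContinuousLinearEquiv : H →L[ℂ] H) =
      ((ρ g⁻¹).toContinuousLinearEquiv : H →L[ℂ] H) := by
  rw [ContinuousLinearMap.star_eq_adjoint, LinearIsometryEquiv.adjoint_eq_symm, map_inv]
  rfl

/-- The graph of the extension of `σ` to the full group C⋆-algebra. -/
def extensionGraph (σ : G →* (K ≃ₗᵢ[ℂ] K)) :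
    StarSubalgebra ℂ ((UniversalSpace G →L[ℂ] UniversalSpace G) × (K →L[ℂ] K)) :=
  (StarAlgebra.adjoin ℂ (Set.range fun g : G =>
    (((universalRep G g).toContinuousLinearEquiv : UniversalSpace G →L[ℂ] UniversalSpace G),
      ((σ g).toContinuousLinearEquiv : K →L[ℂ] K)))).topologicalClosure

/-- Pairs of operators which, together with their adjoints, are intertwined by `R`. -/
def intertwinedPairs {H : Type*} [NormedAddCommGroup H] [InnerProductSpace ℂ H] [CompleteSpace H]
    (R : H →L[ℂ] K) : StarSubalgebra ℂ ((H →L[ℂ] H) × (K →L[ℂ] K)) where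
  carrier := {p | p.2 ∘L R = R ∘L p.1 ∧ star p.2 ∘L R = R ∘L star p.1}
  mul_mem' := by
    rintro ⟨a, b⟩ ⟨a', b'⟩ ⟨h₁, h₂⟩ ⟨h₁', h₂'⟩
    simp only [Set.mem_ofPred_eq, Prod.mk_mul_mk, star_mul] at *
    constructor
    · rw [ContinuousLinearMap.mul_def, ContinuousLinearMap.comp_assoc, h₁',
        ← ContinuousLinearMap.comp_assoc, h₁]
      rfl
    · rw [ContinuousLinearMap.mul_def, ContinuousLinearMap.comp_assoc, h₂,
        ← ContinuousLinearMap.comp_assoc, h₂']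
      rfl
  add_mem' := by
    rintro ⟨a, b⟩ ⟨a', b'⟩ ⟨h₁, h₂⟩ ⟨h₁', h₂'⟩
    simp only [Set.mem_ofPred_eq, Prod.mk_add_mk, star_add] at *
    simp [ContinuousLinearMap.add_comp, ContinuousLinearMap.comp_add, *]
  algebraMap_mem' c := by
    simp only [Set.mem_ofPred_eq, Algebra.algebraMap_eq_smul_one]
    constructor <;> ext x <;> simp
  star_mem' := by
    rintro ⟨a, b⟩ ⟨h₁, h₂⟩
    exact ⟨h₂, by simpa using h₁⟩

theorem isClosed_intertwinedPairs {H : Type*} [NormedAddCommGroup H] [InnerProductSpace ℂ H]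
    [CompleteSpace H] (R : H →L[ℂ] K) :
    IsClosed (intertwinedPairs R : Set ((H →L[ℂ] H) × (K →L[ℂ] K))) := by
  refine IsClosed.inter (isClosed_eq ?_ ?_) (isClosed_eq ?_ ?_) <;> fun_prop

/-- With `ξ = R η` and `‖η‖ = ‖ξ‖`, intertwining gives `‖p.2 ξ‖ = ‖R (p.1 η)‖ ≤ ‖p.1‖ ‖ξ‖`.
Intertwining passes from group elements to the closure because the intertwined pairs form a closed
`⋆`-algebra. -/
theorem norm_snd_le_of_mem_extensionGraph (σ : G →* (K ≃ₗᵢ[ℂ] K))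
    {p : (UniversalSpace G →L[ℂ] UniversalSpace G) × (K →L[ℂ] K)}
    (hp : p ∈ extensionGraph σ) : ‖p.2‖ ≤ ‖p.1‖ := by
  refine ContinuousLinearMap.opNorm_le_bound _ (norm_nonneg _) fun ξ => ?_
  obtain ⟨R, hR, hRσ, η, rfl, hη⟩ := exists_intertwiner σ ξ
  have hle : extensionGraph σ ≤ intertwinedPairs R := by
    refine StarSubalgebra.topologicalClosure_minimal (StarAlgebra.adjoin_le ?_)
      (isClosed_intertwinedPairs R)
    rintro _ ⟨g, rfl⟩
    refine ⟨?_, ?_⟩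
    · ext x
      exact (hRσ g x).symm
    · simp only [star_unitaryRep]
      ext x
      exact (hRσ g⁻¹ x).symm
  have h := DFunLike.congr_fun (hle hp).1 η
  simp only [ContinuousLinearMap.comp_apply] at h
  rw [h, ← hη]
  exact (hR _).trans (p.1.le_opNorm η)

/-- **Universal property of the full group C⋆-algebra**: a unitary representation of `G`, in
whatever universe, with values in a closed `⋆`-algebra extends to `C⋆(G)`. -/
theorem FullGroupCStar.exists_starAlgHom (σ : G →* (K ≃ₗᵢ[ℂ] K)) (B : StarSubalgebra ℂ (K →L[ℂ] K))
    (hB : IsClosed (B : Set (K →L[ℂ] K)))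
    (hσ : ∀ g, ((σ g).toContinuousLinearEquiv : K →L[ℂ] K) ∈ B) :
    ∃ φ : FullGroupCStar G →⋆ₐ[ℂ] B, ∀ g, (φ (FullGroupCStar.of g) : K →L[ℂ] K) =
      ((σ g).toContinuousLinearEquiv : K →L[ℂ] K) := by
  set D := extensionGraph σ
  have hDc : IsClosed (D : Set ((UniversalSpace G →L[ℂ] UniversalSpace G) × (K →L[ℂ] K))) :=
    StarSubalgebra.isClosed_topologicalClosure _
  have : CompleteSpace D := hDc.completeSpace_coe
  let fst : D →⋆ₐ[ℂ] (UniversalSpace G →L[ℂ] UniversalSpace G) :=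
    (StarAlgHom.fst ℂ _ _).comp D.subtype
  -- The product carries the maximum norm, so the first projection is isometric on the graph. Its
  -- image is then closed and contains all of `C⋆(G)`; the extension is the second projection after
  -- the inverse of the first.
  have hnorm : ∀ p : D, ‖fst p‖ = ‖p‖ := fun p => by
    change ‖p.1.1‖ = max ‖p.1.1‖ ‖p.1.2‖
    rw [max_eq_left (norm_snd_le_of_mem_extensionGraph σ p.2)]
  have hiso : Isometry fst := AddMonoidHomClass.isometry_of_norm fst hnorm
  have hrange : FullGroupCStar G ≤ fst.range := by
    refine StarSubalgebra.topologicalClosure_minimal (StarAlgebra.adjoin_le ?_) ?_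
    · rintro _ ⟨g, rfl⟩
      exact ⟨⟨_, StarSubalgebra.le_topologicalClosure _
        (StarAlgebra.subset_adjoin ℂ _ ⟨g, rfl⟩)⟩, rfl⟩
    · exact hiso.isClosedEmbedding.isClosed_range
  have hDB : ∀ p : D, p.1.2 ∈ B := by
    have : D ≤ B.comap (StarAlgHom.snd ℂ _ _) := by
      refine StarSubalgebra.topologicalClosure_minimal (StarAlgebra.adjoin_le ?_)
        (hB.preimage continuous_snd)
      rintro _ ⟨g, rfl⟩
      exact hσ g
    exact fun p => this p.2
  let e : D ≃⋆ₐ[ℂ] fst.range := StarAlgEquiv.ofInjective fst hiso.injective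
  let φ : FullGroupCStar G →⋆ₐ[ℂ] B :=
    (StarAlgHom.codRestrict ((StarAlgHom.snd ℂ _ _).comp D.subtype) B hDB).comp
      ((e.symm : fst.range →⋆ₐ[ℂ] D).comp (StarSubalgebra.inclusion hrange))
  refine ⟨φ, fun g => ?_⟩
  have he : e.symm (StarSubalgebra.inclusion hrange (FullGroupCStar.of g)) =
      ⟨_, StarSubalgebra.le_topologicalClosure _ (StarAlgebra.subset_adjoin ℂ _ ⟨g, rfl⟩)⟩ := by
    rw [StarAlgEquiv.symm_apply_eq]
    rfl
  change (e.symm (StarSubalgebra.inclusion hrange (FullGroupCStar.of g))).1.2 = _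
  rw [he]

end UniversalProperty

/-! ## Tensor products of representations -/

section TensorRep

variable {H : Type u} [NormedAddCommGroup H] [InnerProductSpace ℂ H]
  {K : Type v} [NormedAddCommGroup K] [InnerProductSpace ℂ K]

theorem HilbertTensor.clm_ext {S T : HilbertTensor H K →L[ℂ] HilbertTensor H K}
    (h : ∀ x y, S (HilbertTensor.incl (x ⊗ₜ[ℂ] y)) = T (HilbertTensor.incl (x ⊗ₜ[ℂ] y))) :
    S = T := by
  refine DFunLike.coe_injective
    (HilbertTensor.denseRange_incl.equalizer S.continuous T.continuous (funext fun z => ?_))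
  induction z with
  | zero => simp
  | tmul x y => exact h x y
  | add z w hz hw =>
    simp only [Function.comp_apply, map_add] at *
    rw [hz, hw]

variable [CompleteSpace H] [CompleteSpace K]

theorem opTensor_mul (S S' : H →L[ℂ] H) (T T' : K →L[ℂ] K) :
    opTensor (S * S') (T * T') = opTensor S T * opTensor S' T' :=
  HilbertTensor.clm_ext fun x y => by
    simp [opTensor_incl_tmul]

theorem opTensor_one : opTensor (1 : H →L[ℂ] H) (1 : K →L[ℂ] K) = 1 :=
  HilbertTensor.clm_ext fun x y => by
    simp [opTensor_incl_tmul]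

theorem norm_opTensor_unitary (U : H ≃ₗᵢ[ℂ] H) (V : K ≃ₗᵢ[ℂ] K) (z : HilbertTensor H K) :
    ‖opTensor (U.toContinuousLinearEquiv : H →L[ℂ] H) (V.toContinuousLinearEquiv : K →L[ℂ] K) z‖ =
      ‖z‖ := by
  refine congrFun (HilbertTensor.denseRange_incl.equalizer
    (opTensor (U.toContinuousLinearEquiv : H →L[ℂ] H)
      (V.toContinuousLinearEquiv : K →L[ℂ] K)).continuous.norm continuous_norm
    (funext fun w => ?_)) z
  have h : opTensor (U.toContinuousLinearEquiv : H →L[ℂ] H)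
      (V.toContinuousLinearEquiv : K →L[ℂ] K) (HilbertTensor.incl w) =
      HilbertTensor.incl (TensorProduct.congrIsometry U V w) := by
    induction w with
    | zero => simp
    | tmul x y => exact opTensor_incl_tmul _ _ x y
    | add z w hz hw => simp only [map_add, hz, hw]
  simp only [Function.comp_apply]
  rw [h, LinearIsometry.norm_map, LinearIsometryEquiv.norm_map, LinearIsometry.norm_map]

variable {G : Type*} [Group G]

/-- The operators of a representation, as elements of `B(H)`. -/
def repOp (ρ : G →* (H ≃ₗᵢ[ℂ] H)) : G →* (H →L[ℂ] H) where
  toFun g := ((ρ g).toContinuousLinearEquiv : H →L[ℂ] H)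
  map_one' := by ext; simp
  map_mul' g h := by ext; simp

theorem opTensor_repOp_mul (π : G →* (H ≃ₗᵢ[ℂ] H)) (ρ : G →* (K ≃ₗᵢ[ℂ] K)) (g h : G) :
    opTensor (repOp π (g * h)) (repOp ρ (g * h)) =
      opTensor (repOp π g) (repOp ρ g) * opTensor (repOp π h) (repOp ρ h) := by
  rw [map_mul, map_mul, opTensor_mul]

/-- The tensor product of unitary representations. -/
def tensorRep (π : G →* (H ≃ₗᵢ[ℂ] H)) (ρ : G →* (K ≃ₗᵢ[ℂ] K)) :
    G →* (HilbertTensor H K ≃ₗᵢ[ℂ] HilbertTensor H K) where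
  toFun g :=
    { toFun := opTensor (repOp π g) (repOp ρ g)
      invFun := opTensor (repOp π g⁻¹) (repOp ρ g⁻¹)
      map_add' := map_add _
      map_smul' := map_smul _
      left_inv := fun z => by
        rw [← mul_apply_eq_comp, ← opTensor_repOp_mul]
        simp [opTensor_one]
      right_inv := fun z => by
        rw [← mul_apply_eq_comp, ← opTensor_repOp_mul]
        simp [opTensor_one]
      norm_map' := norm_opTensor_unitary (π g) (ρ g) }
  map_one' := by
    ext z
    change opTensor (repOp π 1) (repOp ρ 1) z = z
    simp [opTensor_one]
  map_mul' g h := by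
    ext z
    change opTensor (repOp π (g * h)) (repOp ρ (g * h)) z = _
    rw [opTensor_repOp_mul]
    rfl

/-- The group elements, as elements of the generated C⋆-algebra. -/
def generatedCStar.ofHom (ρ : G →* (H ≃ₗᵢ[ℂ] H)) : G →* generatedCStar ρ where
  toFun := generatedCStar.of ρ
  map_one' := Subtype.ext (map_one (repOp ρ))
  map_mul' g h := Subtype.ext (map_mul (repOp ρ) g h)

/-- The homomorphism `g ↦ α g ⊗ β g` to the minimal tensor product of generated C⋆-algebras. -/
def generatedCStar.tensorHom {G₁ G₂ : Type*} [Group G₁] [Group G₂] (π : G₁ →* (H ≃ₗᵢ[ℂ] H))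
    (ρ : G₂ →* (K ≃ₗᵢ[ℂ] K)) (α : G →* G₁) (β : G →* G₂) :
    G →* minTensor (generatedCStar π) (generatedCStar ρ) where
  toFun g := minTensor.tmul (generatedCStar.of π (α g)) (generatedCStar.of ρ (β g))
  map_one' := Subtype.ext <| by
    change opTensor (repOp (π.comp α) 1) (repOp (ρ.comp β) 1) = 1
    rw [map_one, map_one, opTensor_one]
  map_mul' g h := Subtype.ext (opTensor_repOp_mul (π.comp α) (ρ.comp β) g h)

end TensorRep

/-! ## Homomorphisms out of group C⋆-algebras of free groups -/

section Hom

variable {H : Type v} [NormedAddCommGroup H] [InnerProductSpace ℂ H] [CompleteSpace H]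
  {G : Type u} [Group G]

/-- `⋆`-homomorphisms of C⋆-algebras are contractive, hence continuous, and the group elements
generate a dense `⋆`-algebra. -/
theorem generatedCStar.starAlgHom_ext (ρ : G →* (H ≃ₗᵢ[ℂ] H)) {B : Type*} [CStarAlgebra B]
    {φ ψ : generatedCStar ρ →⋆ₐ[ℂ] B}
    (h : ∀ g, φ (generatedCStar.of ρ g) = ψ (generatedCStar.of ρ g)) : φ = ψ := by
  have hc : ∀ θ : generatedCStar ρ →⋆ₐ[ℂ] B, Continuous θ := fun θ =>
    AddMonoidHomClass.continuous_of_bound θ 1 fun a => by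
      rw [one_mul]
      exact NonUnitalStarAlgHom.norm_apply_le θ a
  refine StarAlgHom.ext_topologicalClosure (hc φ) (hc ψ) (StarAlgHom.ext_adjoin ?_)
  rintro ⟨_, _⟩ ⟨g, rfl⟩
  exact h g

/-- Two homomorphisms on a group C⋆-algebra of a free group agree on all group elements if they
agree on free generators. -/
theorem generatedCStar.eqOn_freeGroup {P M : Type*} {ρ : FreeGroup P →* (H ≃ₗᵢ[ℂ] H)} [Monoid M]
    (φ : generatedCStar ρ →* M) (f : FreeGroup P →* M)
    (h : ∀ x, φ (generatedCStar.of ρ (FreeGroup.of x)) = f (FreeGroup.of x)) (g : FreeGroup P) :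
    φ (generatedCStar.of ρ g) = f g :=
  DFunLike.congr_fun (FreeGroup.ext_hom (φ.comp (generatedCStar.ofHom ρ)) f h) g

end Hom

/-- The tensor product comultiplication `C⋆(F_P) → C⋆(F_I) ⊗ C⋆(F_J)` exists and is unique. -/
theorem existsUnique_comultiplication {P I J : Type u} (p : P → I) (q : P → J) :
    ∃! φ : FullGroupCStar (FreeGroup P) →⋆ₐ[ℂ]
        minTensor (FullGroupCStar (FreeGroup I)) (FullGroupCStar (FreeGroup J)),
      ∀ x, φ (FullGroupCStar.of (FreeGroup.of x)) =
        minTensor.tmul (FullGroupCStar.of (FreeGroup.of (p x)))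
          (FullGroupCStar.of (FreeGroup.of (q x))) := by
  have hB := minTensor_isClosed (FullGroupCStar (FreeGroup I)) (FullGroupCStar (FreeGroup J))
  let f := generatedCStar.tensorHom (universalRep (FreeGroup I)) (universalRep (FreeGroup J))
    (FreeGroup.map p) (FreeGroup.map q)
  obtain ⟨φ, hφ⟩ := FullGroupCStar.exists_starAlgHom
    (tensorRep ((universalRep (FreeGroup I)).comp (FreeGroup.map p))
      ((universalRep (FreeGroup J)).comp (FreeGroup.map q))) _ hB fun g => (f g).2
  replace hφ : ∀ g, φ (FullGroupCStar.of g) = f g := fun g => Subtype.ext (hφ g)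
  refine ⟨φ, fun x => hφ _, fun ψ hψ => ?_⟩
  refine generatedCStar.starAlgHom_ext _ fun g => ?_
  rw [hφ]
  exact generatedCStar.eqOn_freeGroup (MonoidHomClass.toMonoidHom ψ) f hψ g

/-! ## Averages of conjugates in the regular representation -/

section Averages

variable {H : Type u} [NormedAddCommGroup H] [InnerProductSpace ℂ H]

/-- Bessel's inequality for orthogonal subspaces. -/
theorem sum_norm_starProjection_sq_le {k : ℕ} (V : Fin k → Submodule ℂ H)
    [∀ i, (V i).HasOrthogonalProjection] (hV : ∀ i j, i ≠ j → V i ⟂ V j) (x : H) :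
    ∑ i, ‖(V i).starProjection x‖ ^ 2 ≤ ‖x‖ ^ 2 := by
  set z := ∑ i, (V i).starProjection x
  have h₁ : inner ℂ z x = ((∑ i, ‖(V i).starProjection x‖ ^ 2 : ℝ) : ℂ) := by
    rw [sum_inner, Complex.ofReal_sum]
    refine Finset.sum_congr rfl fun i _ => ?_
    rw [← Submodule.starProjection_eq_self_iff.2 (Submodule.starProjection_apply_mem (V i) x),
      Submodule.inner_starProjection_left_eq_right,
      Submodule.starProjection_eq_self_iff.2 (Submodule.starProjection_apply_mem (V i) x),
      inner_self_eq_norm_sq_to_K]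
    simp
  have h₂ : inner ℂ z z = ((∑ i, ‖(V i).starProjection x‖ ^ 2 : ℝ) : ℂ) := by
    rw [sum_inner, Complex.ofReal_sum]
    refine Finset.sum_congr rfl fun i _ => ?_
    rw [inner_sum, Finset.sum_eq_single i, inner_self_eq_norm_sq_to_K]
    · simp
    · intro j _ hj
      exact (hV i j hj.symm).inner_eq (Submodule.starProjection_apply_mem _ _)
        (Submodule.starProjection_apply_mem _ _)
    · simp
  have h₃ : ‖z‖ ^ 2 = ∑ i, ‖(V i).starProjection x‖ ^ 2 := by
    refine Complex.ofReal_injective ?_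
    rw [← h₂, inner_self_eq_norm_sq_to_K]
    simp
  have h₄ := norm_inner_le_norm (𝕜 := ℂ) z x
  rw [h₁, ← h₃, Complex.norm_real, Real.norm_of_nonneg (sq_nonneg _)] at h₄
  rw [← h₃]
  -- Here `h₄` reads `‖z‖² ≤ ‖z‖ ‖x‖`; the factor `‖z‖` cancels unless it vanishes.
  rcases (norm_nonneg z).eq_or_lt with h | h
  · rw [← h, zero_pow two_ne_zero]
    positivity
  · have : ‖z‖ ≤ ‖x‖ := by nlinarith
    gcongr

/-- Cauchy–Schwarz against the constant vector, then Bessel. -/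
theorem sum_norm_starProjection_le {k : ℕ} (V : Fin k → Submodule ℂ H)
    [∀ i, (V i).HasOrthogonalProjection] (hV : ∀ i j, i ≠ j → V i ⟂ V j) (x : H) :
    ∑ i, ‖(V i).starProjection x‖ ≤ √k * ‖x‖ := by
  refine le_of_sq_le_sq ?_ (by positivity)
  calc (∑ i, ‖(V i).starProjection x‖) ^ 2
      ≤ k * ∑ i, ‖(V i).starProjection x‖ ^ 2 := by
        simpa using sq_sum_le_card_mul_sum_sq (s := Finset.univ)
          (f := fun i => ‖(V i).starProjection x‖)
    _ ≤ k * ‖x‖ ^ 2 := by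
        gcongr
        exact sum_norm_starProjection_sq_le V hV x
    _ = (√k * ‖x‖) ^ 2 := by rw [mul_pow, Real.sq_sqrt (by positivity)]

/-- Powers' estimate: contractions `T i` which map the orthogonal complements of orthogonal
subspaces `V i` to `V i` have a small sum. -/
theorem norm_sum_le_of_mapsTo_orthogonal {k : ℕ} (V : Fin k → Submodule ℂ H)
    [∀ i, (V i).HasOrthogonalProjection] (hV : ∀ i j, i ≠ j → V i ⟂ V j)
    (T : Fin k → H →L[ℂ] H) (hT : ∀ i x, ‖T i x‖ ≤ ‖x‖)
    (hTV : ∀ i, ∀ x ∈ (V i)ᗮ, T i x ∈ V i) : ‖∑ i, T i‖ ≤ 2 * √k := by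
  refine ContinuousLinearMap.opNorm_le_of_re_inner_le (𝕜 := ℂ) (by positivity) fun x y hx₁ hy₁ => ?_
  -- Split `x` and `y` along `V i` and its complement. The term with both complementary parts
  -- vanishes by `hTV`; each remaining term contains a projection to `V i`, and the two sums over
  -- `i` contribute `√k` each.
  have key : ∀ i, ‖inner ℂ (T i x) y‖ ≤
      ‖x‖ * ‖(V i).starProjection y‖ + ‖(V i).starProjection x‖ * ‖y‖ := by
    intro i
    set P := (V i).starProjection
    have hx : T i x = T i (P x) + T i (x - P x) := by rw [← map_add, add_sub_cancel]
    have h₁ : inner ℂ (T i (x - P x)) (y - P y) = 0 :=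
      Submodule.inner_right_of_mem_orthogonal
        (hTV i _ (Submodule.sub_starProjection_mem_orthogonal x))
        (Submodule.sub_starProjection_mem_orthogonal y)
    have h₂ : inner ℂ (T i x) y = inner ℂ (T i x) (P y) + inner ℂ (T i (P x)) (y - P y) := by
      nth_rewrite 1 [← add_sub_cancel (P y) y]
      rw [inner_add_right]
      congr 1
      rw [hx, inner_add_left, h₁, add_zero]
    rw [h₂]
    refine (norm_add_le _ _).trans (add_le_add ?_ ?_)
    · exact (norm_inner_le_norm _ _).trans (by gcongr; exact hT i x)
    · refine (norm_inner_le_norm _ _).trans ?_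
      gcongr
      · exact hT i _
      · rw [← Submodule.starProjection_orthogonal_val]
        exact Submodule.norm_starProjection_apply_le _ _
  rw [sum_apply, sum_inner]
  refine (Complex.re_le_norm _).trans ((norm_sum_le _ _).trans
    ((Finset.sum_le_sum fun i _ => key i).trans ?_))
  rw [Finset.sum_add_distrib, ← Finset.mul_sum, ← Finset.sum_mul]
  have hx := sum_norm_starProjection_le V hV x
  have hy := sum_norm_starProjection_le V hV y
  rw [hx₁, hy₁] at *
  linarith

variable {G : Type u}

/-- The subspace of `ℓ²(G)` of the functions supported in `E`. -/
def supportedOn (E : Set G) : Submodule ℂ (lp (fun _ : G => ℂ) 2) where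
  carrier := {x | ∀ h ∉ E, x h = 0}
  add_mem' {x y} hx hy h hh := by
    change x h + y h = 0
    rw [hx h hh, hy h hh, add_zero]
  zero_mem' _ _ := rfl
  smul_mem' c x hx h hh := by
    change c • x h = 0
    rw [hx h hh, smul_zero]

theorem isClosed_supportedOn (E : Set G) :
    IsClosed (supportedOn E : Set (lp (fun _ : G => ℂ) 2)) := by
  have : (supportedOn E : Set (lp (fun _ : G => ℂ) 2)) =
      ⋂ h ∈ Eᶜ, {x | lp.evalCLM ℂ (fun _ : G => ℂ) 2 h x = 0} := by
    ext x
    simp only [Set.mem_iInter]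
    rfl
  rw [this]
  exact isClosed_biInter fun h _ =>
    isClosed_eq (lp.evalCLM ℂ (fun _ : G => ℂ) 2 h).continuous continuous_const

instance supportedOn_completeSpace (E : Set G) : CompleteSpace (supportedOn E) :=
  (isClosed_supportedOn E).completeSpace_coe

theorem supportedOn_isOrtho {E F : Set G} (h : Disjoint E F) :
    supportedOn E ⟂ supportedOn F := by
  rw [Submodule.isOrtho_iff_inner_eq]
  intro x hx y hy
  rw [lp.inner_eq_tsum]
  refine (tsum_congr fun g => ?_).trans tsum_zero
  by_cases hg : g ∈ E
  · rw [hy g (Set.disjoint_left.1 h hg), inner_zero_right]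
  · rw [hx g hg, inner_zero_left]

/-- The delta function at `h` is supported in `E`, and pairing with it evaluates at `h`. -/
theorem apply_eq_zero_of_mem_supportedOn_orthogonal {E : Set G} {x : lp (fun _ : G => ℂ) 2}
    (hx : x ∈ (supportedOn E)ᗮ) {h : G} (hh : h ∈ E) : x h = 0 := by
  classical
  have hs : lp.single 2 h (1 : ℂ) ∈ supportedOn E := fun g hg =>
    lp.single_apply_ne 2 h 1 fun e => hg (e ▸ hh)
  have := Submodule.inner_right_of_mem_orthogonal hs hx
  rw [lp.inner_single_left] at this
  simpa using this

variable [Group G]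

/-- Powers' estimate for the subspaces `ℓ²(g i E)`: they are orthogonal because the translates are
disjoint, and the `i`-th conjugate of `v` moves the complement of `g i E` into `g i E`. -/
theorem norm_sum_regularRep_conj_le {k : ℕ} (E : Set G) (v : G) (hv : ∀ h ∉ E, v * h ∈ E)
    (g : Fin k → G) (hg : ∀ i j, i ≠ j → ∀ h, (g i)⁻¹ * h ∈ E → (g j)⁻¹ * h ∉ E) :
    ‖∑ i, repOp (regularRep G) (g i * v * (g i)⁻¹)‖ ≤ 2 * √k := by
  refine norm_sum_le_of_mapsTo_orthogonal (fun i => supportedOn {h | (g i)⁻¹ * h ∈ E})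
    (fun i j hij => supportedOn_isOrtho (Set.disjoint_left.2 (hg i j hij))) _
    (fun i x => ((regularRep G (g i * v * (g i)⁻¹)).norm_map x).le) fun i x hx h hh => ?_
  change x ((g i * v * (g i)⁻¹)⁻¹ * h) = 0
  refine apply_eq_zero_of_mem_supportedOn_orthogonal hx ?_
  by_contra hn
  refine hh ?_
  have := hv _ hn
  have e : v * ((g i)⁻¹ * ((g i * v * (g i)⁻¹)⁻¹ * h)) = (g i)⁻¹ * h := by group
  rwa [e] at this

end Averages

/-! ## A word in the kernel of the comultiplication -/

section Word

variable {P : Type*}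

/-- The word `a b⁻¹ d c⁻¹`. -/
def rectangleWord (a b c d : P) : FreeGroup P :=
  FreeGroup.of a * (FreeGroup.of b)⁻¹ * FreeGroup.of d * (FreeGroup.of c)⁻¹

open FreeGroup

variable [DecidableEq P]

theorem of_mul_mem_startsWith {a : P} {h : FreeGroup P} (hh : h ∉ startsWith (a, false)) :
    of a * h ∈ startsWith (a, true) :=
  startsWith_mk_mul (w := (a, true)) h hh

theorem of_inv_mul_mem_startsWith {a : P} {h : FreeGroup P} (hh : h ∉ startsWith (a, true)) :
    (of a)⁻¹ * h ∈ startsWith (a, false) :=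
  startsWith_mk_mul (w := (a, false)) h hh

theorem notMem_startsWith {w w' : P × Bool} {h : FreeGroup P} (hh : h ∈ startsWith w)
    (hw : w ≠ w') : h ∉ startsWith w' :=
  Set.disjoint_left.1 (startsWith.disjoint_iff_ne.2 hw) hh

/-- The letters act one by one from the right. The condition on `h` and the three inequalities say
that no letter cancels against the one it meets. -/
theorem rectangleWord_mul_mem {a b c d : P} (hab : a ≠ b) (hbd : b ≠ d) (hcd : c ≠ d)
    {h : FreeGroup P} (hh : h ∉ startsWith (c, true)) :
    rectangleWord a b c d * h ∈ startsWith (a, true) := by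
  simp only [rectangleWord, mul_assoc]
  have h₁ := of_inv_mul_mem_startsWith hh
  have h₂ := of_mul_mem_startsWith (notMem_startsWith h₁ (w' := (d, false)) (by simp [hcd]))
  have h₃ := of_inv_mul_mem_startsWith
    (notMem_startsWith h₂ (w' := (b, true)) (by simp [hbd.symm]))
  exact of_mul_mem_startsWith (notMem_startsWith h₃ (by simp [hab.symm]))

theorem rectangleWord_ne_one {a b c d : P} (hab : a ≠ b) (hbd : b ≠ d) (hcd : c ≠ d) :
    rectangleWord a b c d ≠ 1 := by
  have := rectangleWord_mul_mem hab hbd hcd (h := 1) fun h => startsWith.ne_one _ h rfl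
  rw [mul_one] at this
  exact startsWith.ne_one _ this

theorem of_pow_mul_mem_startsWith {b : P} {h : FreeGroup P} (hh : h ∉ startsWith (b, false))
    (n : ℕ) : of b ^ (n + 1) * h ∈ startsWith (b, true) := by
  induction n with
  | zero => simpa using of_mul_mem_startsWith hh
  | succ n ih =>
    rw [pow_succ', mul_assoc]
    exact of_mul_mem_startsWith (notMem_startsWith ih (by simp))

theorem norm_sum_rectangleWord_conj_le {P : Type u} {a b c d : P} (hab : a ≠ b) (hbc : b ≠ c)
    (hbd : b ≠ d) (hcd : c ≠ d) (k : ℕ) :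
    ‖∑ i : Fin k, repOp (regularRep (FreeGroup P))
      (of b ^ (i : ℕ) * rectangleWord a b c d * (of b ^ (i : ℕ))⁻¹)‖ ≤ 2 * √k := by
  classical
  -- Words beginning with `c` belong to `E` because the rectangle word may cancel against them, and
  -- words beginning with `a` because it maps all others there.
  let E : Set (FreeGroup P) := startsWith (a, true) ∪ startsWith (c, true)
  have hE : ∀ β, ∀ h ∈ E, h ∉ startsWith (b, β) := by
    rintro β h (hh | hh)
    · exact notMem_startsWith hh (by simp [hab])
    · exact notMem_startsWith hh (by simp [hbc.symm])
  have hlt : ∀ i j : ℕ, i < j → ∀ h, (of b ^ i)⁻¹ * h ∈ E → (of b ^ j)⁻¹ * h ∉ E := by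
    intro i j hij h hi hj
    obtain ⟨n, rfl⟩ : ∃ n, j = i + (n + 1) := ⟨j - i - 1, by omega⟩
    -- If `h` were in both translates, `b⁻ⁱ h = bⁿ⁺¹ (b⁻ʲ h)` would begin with `b`, which no element
    -- of `E` does.
    have := of_pow_mul_mem_startsWith (hE false _ hj) n
    refine hE true _ hi ?_
    convert this using 1
    rw [pow_add]
    group
  refine norm_sum_regularRep_conj_le E _
    (fun h hh => Or.inl (rectangleWord_mul_mem hab hbd hcd fun hc => hh (Or.inr hc)))
    (fun i : Fin k => of b ^ (i : ℕ)) fun i j hij h hi hj => ?_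
  rcases lt_or_gt_of_ne (Fin.val_ne_of_ne hij) with hij | hij
  · exact hlt i j hij h hi hj
  · exact hlt j i hij h hj hi

end Word

/-! ## Failure of injectivity, and the reduced algebras -/

theorem generatedCStar.tensorHom_rectangleWord {H : Type u} [NormedAddCommGroup H]
    [InnerProductSpace ℂ H] [CompleteSpace H] {K : Type v} [NormedAddCommGroup K]
    [InnerProductSpace ℂ K] [CompleteSpace K] {P I J : Type*} (π : FreeGroup I →* (H ≃ₗᵢ[ℂ] H))
    (ρ : FreeGroup J →* (K ≃ₗᵢ[ℂ] K)) (p : P → I) (q : P → J) {a b c d : P}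
    (hpac : p a = p c) (hpbd : p b = p d) (hqab : q a = q b) (hqcd : q c = q d) :
    generatedCStar.tensorHom π ρ (FreeGroup.map p) (FreeGroup.map q) (rectangleWord a b c d) =
      1 := by
  have hp : FreeGroup.map p (rectangleWord a b c d) = 1 := by
    simp [rectangleWord, hpac, hpbd]
  have hq : FreeGroup.map q (rectangleWord a b c d) = 1 := by
    simp [rectangleWord, hqab, hqcd]
  rw [← map_one (generatedCStar.tensorHom π ρ (FreeGroup.map p) (FreeGroup.map q))]
  change minTensor.tmul (generatedCStar.of π _) (generatedCStar.of ρ _) =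
    minTensor.tmul (generatedCStar.of π _) (generatedCStar.of ρ _)
  rw [hp, hq, map_one, map_one]

theorem regularRep_injective (G : Type u) [Group G] : Function.Injective (regularRep G) := by
  classical
  refine (injective_iff_map_eq_one _).2 fun g hg => ?_
  by_contra hne
  have h : (lp.single 2 (1 : G) (1 : ℂ) : lp (fun _ : G => ℂ) 2) (g⁻¹ * g) =
      (lp.single 2 (1 : G) (1 : ℂ) : lp (fun _ : G => ℂ) 2) g :=
    congrArg (fun T : lp (fun _ : G => ℂ) 2 ≃ₗᵢ[ℂ] lp (fun _ : G => ℂ) 2 =>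
      T (lp.single 2 (1 : G) (1 : ℂ)) g) hg
  rw [inv_mul_cancel, lp.single_apply_self, lp.single_apply_ne 2 1 1 hne] at h
  exact one_ne_zero h

/-- The regular representation extends to `C⋆(G)` and already separates the group elements. -/
theorem FullGroupCStar.of_injective (G : Type u) [Group G] :
    Function.Injective (FullGroupCStar.of : G → FullGroupCStar G) := by
  intro g h hgh
  obtain ⟨χ, hχ⟩ := FullGroupCStar.exists_starAlgHom (regularRep G) ⊤ isClosed_univ
    fun _ => trivial
  have := (hχ g).symm.trans ((congrArg (fun x => (χ x).1) hgh).trans (hχ h))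
  exact regularRep_injective G (LinearIsometryEquiv.ext fun x => DFunLike.congr_fun this x)

/-- If `a, b, c, d` are the corners of a rectangle, the comultiplication is not injective. -/
theorem not_injective_comultiplication {P I J : Type u} (p : P → I) (q : P → J) {a b c d : P}
    (hab : a ≠ b) (hbd : b ≠ d) (hcd : c ≠ d)
    (hpac : p a = p c) (hpbd : p b = p d) (hqab : q a = q b) (hqcd : q c = q d)
    (φ : FullGroupCStar (FreeGroup P) →⋆ₐ[ℂ]
        minTensor (FullGroupCStar (FreeGroup I)) (FullGroupCStar (FreeGroup J)))
    (hφ : ∀ x, φ (FullGroupCStar.of (FreeGroup.of x)) =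
        minTensor.tmul (FullGroupCStar.of (FreeGroup.of (p x)))
          (FullGroupCStar.of (FreeGroup.of (q x)))) :
    ¬ Function.Injective φ := by
  classical
  intro hinj
  let f := generatedCStar.tensorHom (universalRep (FreeGroup I)) (universalRep (FreeGroup J))
    (FreeGroup.map p) (FreeGroup.map q)
  have hf : ∀ g, φ (FullGroupCStar.of g) = f g :=
    generatedCStar.eqOn_freeGroup (MonoidHomClass.toMonoidHom φ) f hφ
  refine rectangleWord_ne_one hab hbd hcd (FullGroupCStar.of_injective _ (hinj ?_))
  rw [hf, hf, map_one]
  exact generatedCStar.tensorHom_rectangleWord _ _ p q hpac hpbd hqab hqcd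

/-- A multiplicative map on a group C⋆-algebra of a free group, unital or not, agrees with a
homomorphism to a monoid on all group elements if it does so on free generators. -/
theorem generatedCStar.eqOn_freeGroup_of_mulHom {H : Type v} [NormedAddCommGroup H]
    [InnerProductSpace ℂ H] [CompleteSpace H] {P M : Type*} [Nonempty P]
    {ρ : FreeGroup P →* (H ≃ₗᵢ[ℂ] H)} [Monoid M] (φ : generatedCStar ρ →ₙ* M)
    (f : FreeGroup P →* M)
    (h : ∀ x, φ (generatedCStar.of ρ (FreeGroup.of x)) = f (FreeGroup.of x)) (g : FreeGroup P) :
    φ (generatedCStar.of ρ g) = f g := by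
  have a := Classical.arbitrary P
  have h_one : φ 1 = 1 := by
    -- The image of one generator is invertible, and cancelling it forces `φ 1 = 1`; this needs a
    -- generator to exist.
    have ha : f (FreeGroup.of a) * φ 1 = f (FreeGroup.of a) := by rw [← h, ← map_mul, mul_one]
    calc φ 1 = f (FreeGroup.of a)⁻¹ * (f (FreeGroup.of a) * φ 1) := by
          rw [← mul_assoc, ← map_mul, inv_mul_cancel, map_one f, one_mul]
      _ = 1 := by rw [ha, ← map_mul, inv_mul_cancel, map_one]
  exact generatedCStar.eqOn_freeGroup ⟨⟨φ, h_one⟩, map_mul φ⟩ f h g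

theorem MonoidHom.map_conj_eq_one {G M : Type*} [Group G] [Monoid M] (f : G →* M) {w : G}
    (hw : f w = 1) (g : G) : f (g * w * g⁻¹) = 1 := by
  rw [map_mul, map_mul, hw, mul_one, ← map_mul, mul_inv_cancel, map_one]

theorem StarSubalgebra.norm_sum_coe {A : Type*} [NormedRing A] [StarRing A] [NormedAlgebra ℂ A]
    [StarModule ℂ A] (S : StarSubalgebra ℂ A) {k : ℕ} (x : Fin k → S) :
    ‖∑ i, x i‖ = ‖∑ i, (x i : A)‖ := by
  rw [← AddSubmonoidClass.coe_finsetSum]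
  rfl

theorem norm_sum_one_le_of_map_eq_one {A B : Type*} [CStarAlgebra A] [CStarAlgebra B]
    (ψ : A →⋆ₙₐ[ℂ] B) {k : ℕ} (x : Fin k → A) (hx : ∀ i, ψ (x i) = 1) :
    ‖∑ _i : Fin k, (1 : B)‖ ≤ ‖∑ i, x i‖ := by
  rw [← Finset.sum_congr rfl fun i _ => hx i, ← map_sum]
  exact NonUnitalStarAlgHom.norm_apply_le ψ _

theorem norm_sum_of_rectangleWord_conj_le {P : Type u} {a b c d : P} (hab : a ≠ b) (hbc : b ≠ c)
    (hbd : b ≠ d) (hcd : c ≠ d) (k : ℕ) :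
    ‖∑ i : Fin k, ReducedGroupCStar.of (FreeGroup.of b ^ (i : ℕ) * rectangleWord a b c d *
      (FreeGroup.of b ^ (i : ℕ))⁻¹)‖ ≤ 2 * √k := by
  refine le_trans (le_of_eq ?_) (norm_sum_rectangleWord_conj_le hab hbc hbd hcd k)
  exact StarSubalgebra.norm_sum_coe _ _

instance HilbertTensor.nontrivial {H : Type u} [NormedAddCommGroup H] [InnerProductSpace ℂ H]
    {K : Type v} [NormedAddCommGroup K] [InnerProductSpace ℂ K] [Nontrivial H] [Nontrivial K] :
    Nontrivial (HilbertTensor H K) := by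
  obtain ⟨x, hx⟩ := exists_ne (0 : H)
  obtain ⟨y, hy⟩ := exists_ne (0 : K)
  refine nontrivial_of_ne (HilbertTensor.incl (x ⊗ₜ[ℂ] y)) 0 fun h => ?_
  have := congrArg norm h
  rw [LinearIsometry.norm_map, TensorProduct.norm_tmul, norm_zero, mul_eq_zero, norm_eq_zero,
    norm_eq_zero] at this
  exact this.elim hx hy

/-- Nontriviality of both spaces gives the identity operator norm one. -/
theorem minTensor.norm_sum_one {H : Type u} [NormedAddCommGroup H] [InnerProductSpace ℂ H]
    [CompleteSpace H] {K : Type v} [NormedAddCommGroup K] [InnerProductSpace ℂ K]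
    [CompleteSpace K] [Nontrivial H] [Nontrivial K] (A : StarSubalgebra ℂ (H →L[ℂ] H))
    (B : StarSubalgebra ℂ (K →L[ℂ] K)) (k : ℕ) : ‖∑ _i : Fin k, (1 : minTensor A B)‖ = k := by
  refine (StarSubalgebra.norm_sum_coe _ _).trans ?_
  have h : ∑ _i : Fin k, (1 : HilbertTensor H K →L[ℂ] HilbertTensor H K) = (k : ℂ) • 1 := by
    simp [← Nat.cast_smul_eq_nsmul ℂ]
  change ‖∑ _i : Fin k, (1 : HilbertTensor H K →L[ℂ] HilbertTensor H K)‖ = k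
  rw [h, norm_smul, norm_one, mul_one, Complex.norm_natCast]

instance lp_complex_nontrivial (G : Type u) [Nonempty G] :
    Nontrivial (lp (fun _ : G => ℂ) 2) := by
  classical
  refine nontrivial_of_ne (lp.single 2 (Classical.arbitrary G) (1 : ℂ)) 0 fun h => ?_
  have := congrArg norm h
  rw [lp.norm_single (by norm_num)] at this
  simp at this

/-- If `a, b, c, d` are the corners of a rectangle, there is no comultiplication on the reduced
group C⋆-algebras. -/
theorem not_exists_reduced_comultiplication {P I J : Type u} (p : P → I) (q : P → J)
    {a b c d : P} (hab : a ≠ b) (hbc : b ≠ c) (hbd : b ≠ d) (hcd : c ≠ d)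
    (hpac : p a = p c) (hpbd : p b = p d) (hqab : q a = q b) (hqcd : q c = q d)
    (ψ : ReducedGroupCStar (FreeGroup P) →⋆ₙₐ[ℂ]
        minTensor (ReducedGroupCStar (FreeGroup I)) (ReducedGroupCStar (FreeGroup J)))
    (hψ : ∀ x, ψ (ReducedGroupCStar.of (FreeGroup.of x)) =
        minTensor.tmul (ReducedGroupCStar.of (FreeGroup.of (p x)))
          (ReducedGroupCStar.of (FreeGroup.of (q x)))) : False := by
  let f := generatedCStar.tensorHom (regularRep (FreeGroup I)) (regularRep (FreeGroup J))
    (FreeGroup.map p) (FreeGroup.map q)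
  have : Nonempty P := ⟨a⟩
  have hf : ∀ g, ψ (ReducedGroupCStar.of g) = f g :=
    generatedCStar.eqOn_freeGroup_of_mulHom (MulHomClass.toMulHom ψ) f hψ
  have hconj : ∀ g, ψ (ReducedGroupCStar.of (g * rectangleWord a b c d * g⁻¹)) = 1 := fun g =>
    (hf _).trans (f.map_conj_eq_one
      (generatedCStar.tensorHom_rectangleWord _ _ p q hpac hpbd hqab hqcd) g)
  -- Five is the least positive `k` with `k > 2√k`.
  have h := (norm_sum_one_le_of_map_eq_one ψ _ fun i : Fin 5 =>
    hconj (FreeGroup.of b ^ (i : ℕ))).trans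
      (norm_sum_of_rectangleWord_conj_le hab hbc hbd hcd 5)
  rw [minTensor.norm_sum_one] at h
  have h5 : √(5 : ℝ) ^ 2 = 5 := Real.sq_sqrt (by norm_num)
  push_cast at h
  nlinarith [Real.sqrt_nonneg 5]

end

/-! ### The theorem for numbered generators. -/

theorem lemma1p1 :
    -- existence (and uniqueness) of `φ_{n,m} : C⋆(F_{nm}) → C⋆(F_n) ⊗ C⋆(F_m)`
    (∀ n m : ℕ, 1 ≤ n → 1 ≤ m →
      ∃! φ : FullGroupCStar (FreeGroup (Fin (n * m))) →⋆ₐ[ℂ]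
          minTensor (FullGroupCStar (FreeGroup (Fin n))) (FullGroupCStar (FreeGroup (Fin m))),
        ∀ (i : Fin n) (j : Fin m), φ (FullGroupCStar.of (freeGen i j)) =
          minTensor.tmul (FullGroupCStar.of (FreeGroup.of i))
            (FullGroupCStar.of (FreeGroup.of j))) ∧
    -- existence (and uniqueness) of `φ_{∞,n} : C⋆(F_∞) → C⋆(F_∞) ⊗ C⋆(F_n)`
    (∀ n : ℕ, 1 ≤ n →
      ∃! φ : FullGroupCStar (FreeGroup ℕ) →⋆ₐ[ℂ]
          minTensor (FullGroupCStar (FreeGroup ℕ)) (FullGroupCStar (FreeGroup (Fin n))),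
        ∀ (i : ℕ) (j : Fin n), φ (FullGroupCStar.of (freeGenInf i j)) =
          minTensor.tmul (FullGroupCStar.of (FreeGroup.of i))
            (FullGroupCStar.of (FreeGroup.of j))) ∧
    -- `φ_{n,m}` is not injective if `n, m ≥ 2`
    (∀ n m : ℕ, 2 ≤ n → 2 ≤ m →
      ∀ φ : FullGroupCStar (FreeGroup (Fin (n * m))) →⋆ₐ[ℂ]
          minTensor (FullGroupCStar (FreeGroup (Fin n))) (FullGroupCStar (FreeGroup (Fin m))),
        (∀ (i : Fin n) (j : Fin m), φ (FullGroupCStar.of (freeGen i j)) =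
          minTensor.tmul (FullGroupCStar.of (FreeGroup.of i))
            (FullGroupCStar.of (FreeGroup.of j))) →
        ¬ Function.Injective φ) ∧
    -- the assignment has no `⋆`-homomorphic extension to the reduced algebras if `n, m ≥ 2`
    (∀ n m : ℕ, 2 ≤ n → 2 ≤ m →
      ¬ ∃ ψ : ReducedGroupCStar (FreeGroup (Fin (n * m))) →⋆ₙₐ[ℂ]
          minTensor (ReducedGroupCStar (FreeGroup (Fin n)))
            (ReducedGroupCStar (FreeGroup (Fin m))),
        ∀ (i : Fin n) (j : Fin m), ψ (ReducedGroupCStar.of (freeGen i j)) =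
          minTensor.tmul (ReducedGroupCStar.of (FreeGroup.of i))
            (ReducedGroupCStar.of (FreeGroup.of j))) := by
  -- Conditions on pairs become conditions on the number `x` of a generator, with quotient and
  -- remainder as coordinate maps. `Q` is left general to serve both the full and the reduced
  -- algebras.
  have key : ∀ {n m : ℕ} {Q : FreeGroup (Fin (n * m)) → Fin n → Fin m → Prop},
      (∀ i j, Q (freeGen i j) i j) ↔
        ∀ x, Q (FreeGroup.of x) (finProdFinEquiv.symm x).1 (finProdFinEquiv.symm x).2 := by
    intro n m Q
    have hgen : ∀ (i : Fin n) (j : Fin m),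
        freeGen i j = FreeGroup.of (finProdFinEquiv (i, j)) := fun i j =>
      congrArg FreeGroup.of (Fin.ext (Nat.add_comm _ _))
    refine ⟨fun h x => ?_, fun h i j => ?_⟩
    · have := h (finProdFinEquiv.symm x).1 (finProdFinEquiv.symm x).2
      rwa [hgen, Prod.mk.eta, Equiv.apply_symm_apply] at this
    · have := h (finProdFinEquiv (i, j))
      rwa [← hgen, Equiv.symm_apply_apply] at this
  have keyInf : ∀ {n : ℕ} [NeZero n] {Q : FreeGroup ℕ → ℕ → Fin n → Prop},
      (∀ i j, Q (freeGenInf i j) i j) ↔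
        ∀ x, Q (FreeGroup.of x) (Nat.divModEquiv n x).1 (Nat.divModEquiv n x).2 := by
    intro n _ Q
    have hgen : ∀ (i : ℕ) (j : Fin n),
        freeGenInf i j = FreeGroup.of ((Nat.divModEquiv n).symm (i, j)) := fun i j =>
      congrArg (fun k => FreeGroup.of (k + (j : ℕ))) (Nat.mul_comm _ _)
    refine ⟨fun h x => ?_, fun h i j => ?_⟩
    · have := h (Nat.divModEquiv n x).1 (Nat.divModEquiv n x).2
      rwa [hgen, Prod.mk.eta, Equiv.symm_apply_apply] at this
    · have := h ((Nat.divModEquiv n).symm (i, j))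
      rwa [← hgen, Equiv.apply_symm_apply] at this
  refine ⟨fun n m _ _ => ?_, fun n hn => ?_, fun n m hn hm φ hφ => ?_, ?_⟩
  · have h := existsUnique_comultiplication (fun x : Fin (n * m) => (finProdFinEquiv.symm x).1)
      (fun x : Fin (n * m) => (finProdFinEquiv.symm x).2)
    refine (existsUnique_congr fun φ => ?_).2 h
    exact key (Q := fun g i j => φ (FullGroupCStar.of g) =
      minTensor.tmul (FullGroupCStar.of (FreeGroup.of i)) (FullGroupCStar.of (FreeGroup.of j)))
  · have : NeZero n := ⟨by omega⟩
    have h := existsUnique_comultiplication (fun x : ℕ => (Nat.divModEquiv n x).1)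
      (fun x : ℕ => (Nat.divModEquiv n x).2)
    refine (existsUnique_congr fun φ => ?_).2 h
    exact keyInf (Q := fun g i j => φ (FullGroupCStar.of g) =
      minTensor.tmul (FullGroupCStar.of (FreeGroup.of i)) (FullGroupCStar.of (FreeGroup.of j)))
  · rw [key (Q := fun g i j => φ (FullGroupCStar.of g) = minTensor.tmul
      (FullGroupCStar.of (FreeGroup.of i)) (FullGroupCStar.of (FreeGroup.of j)))] at hφ
    let i₀ : Fin n := ⟨0, by omega⟩
    let i₁ : Fin n := ⟨1, by omega⟩
    let j₀ : Fin m := ⟨0, by omega⟩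
    let j₁ : Fin m := ⟨1, by omega⟩
    exact not_injective_comultiplication _ _ (a := finProdFinEquiv (i₀, j₀))
      (b := finProdFinEquiv (i₁, j₀)) (c := finProdFinEquiv (i₀, j₁))
      (d := finProdFinEquiv (i₁, j₁)) (by simp [i₀, i₁]) (by simp [j₀, j₁]) (by simp [i₀, i₁])
      (by simp) (by simp) (by simp) (by simp) φ hφ
  · rintro n m hn hm ⟨ψ, hψ⟩
    rw [key (Q := fun g i j => ψ (ReducedGroupCStar.of g) = minTensor.tmul
      (ReducedGroupCStar.of (FreeGroup.of i)) (ReducedGroupCStar.of (FreeGroup.of j)))] at hψ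
    let i₀ : Fin n := ⟨0, by omega⟩
    let i₁ : Fin n := ⟨1, by omega⟩
    let j₀ : Fin m := ⟨0, by omega⟩
    let j₁ : Fin m := ⟨1, by omega⟩
    exact not_exists_reduced_comultiplication _ _ (a := finProdFinEquiv (i₀, j₀))
      (b := finProdFinEquiv (i₁, j₀)) (c := finProdFinEquiv (i₀, j₁))
      (d := finProdFinEquiv (i₁, j₁)) (by simp [i₀, i₁]) (by simp [i₀, i₁]) (by simp [j₀, j₁])
      (by simp [i₀, i₁]) (by simp) (by simp) (by simp) (by simp) ψ hψ
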